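/- Theorem 1. Let $n\ge 1$ and let $S\subset\mathbb R^n$ be a nondegenerate simplex with vertices $x^{(1)},\dots,x^{(n+1)}$, where $x^{(j)}=(x^{(j)}_1,\dots,x^{(j)}_n)$. Let $\mathbf A$ be the $(n+1)\times(n+1)$ vertex matrix of $S$, whose $j$-th row is $(x^{(j)}_1,\dots,x^{(j)}_n,1)$; it is invertible, and we write $\mathbf A^{-1}=(l_{ij})$. Let $B_n=\{x\in\mathbb R^n:\|x\|\le 1\}$ be the Euclidean unit ball. For $\tau>0$ let $\tau S$ be the image of $S$ under the homothety with ratio $\tau$ and center at the center of gravity of $S$, and let $\alpha(B_n;S)$ be the minimal $\tau>0$ such that $B_n$ is contained in a translate of $\tau S$. Let $h_j$ be the height of $S$ from $x^{(j)}$, that is, the distance from $x^{(j)}$ to the hyperplane through the other vertices; let $r$ be the inradius of $S$, that is, the maximum of the radii of balls contained in $S$; let $\sigma$ be the sum of the $(n-1)$-dimensional measures of the $n+1$ facets of $S$ (for $n=1$, the number of endpoints); and let $\operatorname{vol}(S)$ be the volume of $S$. Then the minimum defining $\alpha(B_n;S)$ and the maximum defining $r$ are attained, and $$\alpha(B_n;S)=\sum_{j=1}^{n+1}\Bigl(\sum_{i=1}^n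 l_{ij}^2\Bigr)^{1/2},\qquad \alpha(B_n;S)=\sum_{j=1}^{n+1}\frac1{h_j},\qquad \alpha(B_n;S)=\frac1r,\qquad \alpha(B_n;S)=\frac{\sigma}{n\operatorname{vol}(S)}.$$ -/

import Mathlib

open scoped MeasureTheory

noncomputable section

namespace SimplexBall

/-- The solid simplex with the given vertices: all convex combinations of the vertices. -/
def solid {n m : ℕ} (S : Affine.Simplex ℝ (EuclideanSpace ℝ (Fin n)) m) :
    Set (EuclideanSpace ℝ (Fin n)) :=
  convexHull ℝ (Set.range S.points)

/-- The simplex `τ S`: the image of `S` under the homothety with ratio `τ` whose center is the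
center of gravity of `S`. -/
def dilate {n : ℕ} (τ : ℝ) (S : Affine.Simplex ℝ (EuclideanSpace ℝ (Fin n)) n) :
    Set (EuclideanSpace ℝ (Fin n)) :=
  AffineMap.homothety S.centroid τ '' solid S

/-- The set of all `τ > 0` such that `C` is contained in a translate of `τ S`. -/
def absorbingRatios {n : ℕ} (C : Set (EuclideanSpace ℝ (Fin n)))
    (S : Affine.Simplex ℝ (EuclideanSpace ℝ (Fin n)) n) : Set ℝ :=
  {τ | 0 < τ ∧ ∃ v : EuclideanSpace ℝ (Fin n), C ⊆ (fun x => v + x) '' dilate τ S}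

/-- `α(C;S)`, the minimal `τ > 0` such that `C` is contained in a translate of `τ S`. -/
def alpha {n : ℕ} (C : Set (EuclideanSpace ℝ (Fin n)))
    (S : Affine.Simplex ℝ (EuclideanSpace ℝ (Fin n)) n) : ℝ :=
  sInf (absorbingRatios C S)

/-- The set of radii of the closed balls of positive radius contained in `S`. -/
def inscribedRadii {n : ℕ} (S : Affine.Simplex ℝ (EuclideanSpace ℝ (Fin n)) n) : Set ℝ :=
  {ρ | 0 < ρ ∧ ∃ c : EuclideanSpace ℝ (Fin n), Metric.closedBall c ρ ⊆ solid S}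

/-- The inradius of `S`: the maximum of the radii of the balls contained in `S`. -/
def inradius {n : ℕ} (S : Affine.Simplex ℝ (EuclideanSpace ℝ (Fin n)) n) : ℝ :=
  sSup (inscribedRadii S)

/-- The vertex matrix of `S`: row `j` consists of the `n` coordinates of the vertex `j`,
followed by `1`. -/
def vertexMatrix {n : ℕ} (S : Affine.Simplex ℝ (EuclideanSpace ℝ (Fin n)) n) :
    Matrix (Fin (n + 1)) (Fin (n + 1)) ℝ :=
  Matrix.of fun j => Fin.snoc (α := fun _ => ℝ) (fun i : Fin n => S.points j i) 1

/-- The `(n-1)`-dimensional measure of the facet of `S` opposite to the vertex `j`. The measure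
`μHE[d]` is the `d`-dimensional Hausdorff measure normalized to agree with Lebesgue measure on
`d`-dimensional Euclidean spaces (the counting measure for `d = 0`). -/
def facetMeasure {n : ℕ} [NeZero n] (S : Affine.Simplex ℝ (EuclideanSpace ℝ (Fin n)) n)
    (j : Fin (n + 1)) : ℝ :=
  (μHE[n - 1] : MeasureTheory.Measure (EuclideanSpace ℝ (Fin n))).real (solid (S.faceOpposite j))

/-- The total `(n-1)`-dimensional measure of the facets of `S`. -/
def surface {n : ℕ} [NeZero n] (S : Affine.Simplex ℝ (EuclideanSpace ℝ (Fin n)) n) : ℝ :=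
  ∑ j, facetMeasure S j

/-- The volume of `S`. -/
def vol {n : ℕ} (S : Affine.Simplex ℝ (EuclideanSpace ℝ (Fin n)) n) : ℝ :=
  (MeasureTheory.volume : MeasureTheory.Measure (EuclideanSpace ℝ (Fin n))).real (solid S)

end SimplexBall

end

open scoped RealInnerProductSpace

namespace SimplexBall

variable {n : ℕ}

/-! The simplex is the set where all barycentric coordinates λ_j are nonnegative, and λ_j is affine
with gradient g_j of norm 1/h_j (`coord_linear`, `norm_gradient`). The minimum of λ_j on the ball of
center c and radius ρ is λ_j(c) - ρ/h_j, so the ball lies in S iff ρ/h_j ≤ λ_j(c) for all j. Put s =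
∑ 1/h_j. As ∑ λ_j = 1, summing gives ρ s ≤ 1, and the center with λ_j(c) = 1/(h_j s) serves every
such ρ: the radii fill (0, 1/s] (`inscribedRadii_eq`).

Rescaling by 1/τ turns them into the ratios [s, ∞). The matrix formula holds because column j of the
inverse of A is g_j followed by λ_j(0); the surface formula, because n vol(S) is h_j times the
opposite facet, for each j. -/

/-- The vertices of a nondegenerate simplex of full dimension form an affine basis. -/
noncomputable def affineBasis (S : Affine.Simplex ℝ (EuclideanSpace ℝ (Fin n)) n) :
    AffineBasis (Fin (n + 1)) ℝ (EuclideanSpace ℝ (Fin n)) :=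
  ⟨S.points, S.independent,
    (S.independent.affineSpan_eq_top_iff_card_eq_finrank_add_one).2 (by simp)⟩

@[simp] lemma affineBasis_apply (S : Affine.Simplex ℝ (EuclideanSpace ℝ (Fin n)) n)
    (j : Fin (n + 1)) : affineBasis S j = S.points j := rfl

lemma mem_solid_iff (S : Affine.Simplex ℝ (EuclideanSpace ℝ (Fin n)) n)
    {x : EuclideanSpace ℝ (Fin n)} : x ∈ solid S ↔ ∀ j, 0 ≤ (affineBasis S).coord j x := by
  have h := (affineBasis S).convexHull_eq_nonneg_coord
  exact Set.ext_iff.1 h x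

lemma isCompact_solid {m : ℕ} (S : Affine.Simplex ℝ (EuclideanSpace ℝ (Fin n)) m) :
    IsCompact (solid S) :=
  (Set.finite_range S.points).isCompact_convexHull (𝕜 := ℝ)

lemma coord_point (S : Affine.Simplex ℝ (EuclideanSpace ℝ (Fin n)) n) (j k : Fin (n + 1)) :
    (affineBasis S).coord j (S.points k) = if j = k then 1 else 0 :=
  (affineBasis S).coord_apply j k

/-- The point with prescribed barycentric coordinates. -/
lemma exists_coord_eq (S : Affine.Simplex ℝ (EuclideanSpace ℝ (Fin n)) n) (w : Fin (n + 1) → ℝ)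
    (hw : ∑ j, w j = 1) : ∃ c, ∀ j, (affineBasis S).coord j c = w j :=
  ⟨Finset.univ.affineCombination ℝ (affineBasis S) w, fun j =>
    (affineBasis S).coord_apply_combination_of_mem (Finset.mem_univ j) hw⟩

lemma coord_homothety_point (S : Affine.Simplex ℝ (EuclideanSpace ℝ (Fin n)) n)
    (j k : Fin (n + 1)) (t : ℝ) (x : EuclideanSpace ℝ (Fin n)) :
    (affineBasis S).coord k (AffineMap.homothety (S.points j) t x) =
      t * (affineBasis S).coord k x + (1 - t) * if k = j then 1 else 0 := by
  rw [AffineMap.homothety_eq_lineMap, AffineMap.apply_lineMap, coord_point,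
    AffineMap.lineMap_apply]
  simp only [vsub_eq_sub, smul_eq_mul, vadd_eq_add]
  ring

/-- The inverse of a homothety of ratio τ followed by a translation carries the unit ball to a ball
of radius 1/τ. -/
lemma mem_absorbingRatios_iff (S : Affine.Simplex ℝ (EuclideanSpace ℝ (Fin n)) n) {τ : ℝ} :
    τ ∈ absorbingRatios (Metric.closedBall 0 1) S ↔ τ⁻¹ ∈ inscribedRadii S := by
  rw [absorbingRatios, inscribedRadii, Set.mem_ofPred_eq, Set.mem_ofPred_eq, inv_pos]
  refine and_congr_right fun hτ => ?_
  have key : ∀ v y : EuclideanSpace ℝ (Fin n), y ∈ (fun x => v + x) '' dilate τ S ↔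
      τ⁻¹ • (y - v - S.centroid) + S.centroid ∈ solid S := by
    intro v y
    simp only [dilate, Set.image_image, Set.mem_image, AffineMap.homothety_apply, vsub_eq_sub,
      vadd_eq_add]
    constructor
    · rintro ⟨x, hx, rfl⟩
      convert hx
      rw [show v + (τ • (x - S.centroid) + S.centroid) - v - S.centroid
        = τ • (x - S.centroid) by abel, inv_smul_smul₀ hτ.ne', sub_add_cancel]
    · intro h
      refine ⟨_, h, ?_⟩
      rw [add_sub_cancel_right, smul_inv_smul₀ hτ.ne']
      abel
  constructor
  · rintro ⟨v, hv⟩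
    -- The center is the preimage of the origin under the homothety followed by translation by v.
    refine ⟨τ⁻¹ • (- v - S.centroid) + S.centroid, fun x hx => ?_⟩
    have hy : τ • (x - S.centroid) + v + S.centroid ∈
        Metric.closedBall (0 : EuclideanSpace ℝ (Fin n)) 1 := by
      rw [Metric.mem_closedBall, dist_eq_norm] at hx ⊢
      have : τ • (x - S.centroid) + v + S.centroid - 0 =
          τ • (x - (τ⁻¹ • (- v - S.centroid) + S.centroid)) := by
        rw [← sub_sub, sub_right_comm, smul_sub τ (x - S.centroid), smul_inv_smul₀ hτ.ne']
        abel
      rw [this, norm_smul, Real.norm_of_nonneg hτ.le]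
      calc _ ≤ τ * τ⁻¹ := mul_le_mul_of_nonneg_left hx hτ.le
        _ = 1 := mul_inv_cancel₀ hτ.ne'
    have := (key _ _).1 (hv hy)
    rwa [show τ • (x - S.centroid) + v + S.centroid - v - S.centroid = τ • (x - S.centroid) by abel,
      inv_smul_smul₀ hτ.ne', sub_add_cancel] at this
  · rintro ⟨c, hc⟩
    -- This translation sends the homothetic image of c to the origin.
    refine ⟨- (τ • (c - S.centroid)) - S.centroid, fun y hy => (key _ _).2 (hc ?_)⟩
    rw [mem_closedBall_zero_iff] at hy
    rw [Metric.mem_closedBall, dist_eq_norm]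
    have : τ⁻¹ • (y - (- (τ • (c - S.centroid)) - S.centroid) - S.centroid) + S.centroid - c
        = τ⁻¹ • y := by
      rw [show y - (- (τ • (c - S.centroid)) - S.centroid) - S.centroid
        = y + τ • (c - S.centroid) by abel, smul_add, inv_smul_smul₀ hτ.ne']
      abel
    rw [this, norm_smul, Real.norm_of_nonneg (inv_nonneg.2 hτ.le)]
    exact mul_le_of_le_one_right (inv_nonneg.2 hτ.le) hy

/-! ### Gradients of the barycentric coordinates and inscribed balls -/

variable [NeZero n]

/-- The gradient of the barycentric coordinate of a simplex at the vertex `j`. -/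
noncomputable def gradient (S : Affine.Simplex ℝ (EuclideanSpace ℝ (Fin n)) n)
    (j : Fin (n + 1)) : EuclideanSpace ℝ (Fin n) :=
  (S.height j ^ 2)⁻¹ • (S.points j - S.altitudeFoot j)

lemma norm_gradient (S : Affine.Simplex ℝ (EuclideanSpace ℝ (Fin n)) n) (j : Fin (n + 1)) :
    ‖gradient S j‖ = 1 / S.height j := by
  have h := S.height_pos j
  rw [gradient, norm_smul, ← dist_eq_norm, ← Affine.Simplex.height, Real.norm_of_nonneg (by positivity)]
  field_simp

lemma norm_gradient_pos (S : Affine.Simplex ℝ (EuclideanSpace ℝ (Fin n)) n) (j : Fin (n + 1)) :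
    0 < ‖gradient S j‖ := by
  have h := S.height_pos j
  rw [norm_gradient]
  positivity

/-- It suffices to compare on the edges leaving vertex j: along each, the coordinate drops from 1 to
0, and the edge projects onto the whole altitude. -/
lemma coord_linear (S : Affine.Simplex ℝ (EuclideanSpace ℝ (Fin n)) n) (j : Fin (n + 1)) :
    ((affineBasis S).coord j).linear = (innerSL ℝ (gradient S j)).toLinearMap := by
  refine ((affineBasis S).basisOf j).ext fun k => ?_
  have h := S.height_pos j
  rw [AffineBasis.basisOf_apply, AffineMap.linearMap_vsub]
  have h2 := S.inner_vsub_vsub_altitudeFoot_eq_height_sq (Ne.symm k.2)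
  rw [vsub_eq_sub, vsub_eq_sub, real_inner_comm,
    ← neg_sub (S.points k) (S.points j), inner_neg_right] at h2
  simp only [affineBasis_apply, coord_point, vsub_eq_sub, ContinuousLinearMap.coe_coe,
    innerSL_apply_apply, gradient, real_inner_smul_left, if_neg (Ne.symm k.2)]
  rw [neg_eq_iff_eq_neg.1 h2]
  simp
  field_simp

lemma coord_eq_add_inner (S : Affine.Simplex ℝ (EuclideanSpace ℝ (Fin n)) n) (j : Fin (n + 1))
    (x c : EuclideanSpace ℝ (Fin n)) :
    (affineBasis S).coord j x = (affineBasis S).coord j c + ⟪gradient S j, x - c⟫ := by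
  have h := ((affineBasis S).coord j).linearMap_vsub x c
  rw [coord_linear] at h
  simp only [vsub_eq_sub, ContinuousLinearMap.coe_coe, innerSL_apply_apply] at h
  linarith

lemma closedBall_subset_solid_iff (S : Affine.Simplex ℝ (EuclideanSpace ℝ (Fin n)) n)
    {c : EuclideanSpace ℝ (Fin n)} {ρ : ℝ} (hρ : 0 ≤ ρ) :
    Metric.closedBall c ρ ⊆ solid S ↔
      ∀ j, ρ * ‖gradient S j‖ ≤ (affineBasis S).coord j c := by
  constructor
  · intro h j
    have hg := norm_gradient_pos S j
    -- The point of the ball where coordinate j is smallest.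
    have hm : c - (ρ / ‖gradient S j‖) • gradient S j ∈ Metric.closedBall c ρ := by
      rw [Metric.mem_closedBall, dist_eq_norm, sub_sub_cancel_left, norm_neg, norm_smul,
        Real.norm_of_nonneg (by positivity), div_mul_cancel₀ _ hg.ne']
    have := (mem_solid_iff S).1 (h hm) j
    rw [coord_eq_add_inner S j _ c, sub_sub_cancel_left, inner_neg_right, real_inner_smul_right,
      real_inner_self_eq_norm_sq] at this
    have e : ρ / ‖gradient S j‖ * ‖gradient S j‖ ^ 2 = ρ * ‖gradient S j‖ := by field_simp
    linarith
  · intro h x hx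
    refine (mem_solid_iff S).2 fun j => ?_
    rw [coord_eq_add_inner S j x c]
    have h1 := neg_le_of_abs_le (abs_real_inner_le_norm (gradient S j) (x - c))
    have h2 : ‖x - c‖ ≤ ρ := by rwa [← dist_eq_norm]
    have h3 := mul_le_mul_of_nonneg_left h2 (norm_nonneg (gradient S j))
    linarith [h j]

/-- The sum of the reciprocals of the heights of a simplex. -/
noncomputable def sumInvHeight (S : Affine.Simplex ℝ (EuclideanSpace ℝ (Fin n)) n) : ℝ :=
  ∑ j, 1 / S.height j

lemma sumInvHeight_pos (S : Affine.Simplex ℝ (EuclideanSpace ℝ (Fin n)) n) :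
    0 < sumInvHeight S :=
  Finset.sum_pos (fun j _ => one_div_pos.2 (S.height_pos j)) Finset.univ_nonempty

lemma inscribedRadii_eq (S : Affine.Simplex ℝ (EuclideanSpace ℝ (Fin n)) n) :
    inscribedRadii S = Set.Ioc 0 (1 / sumInvHeight S) := by
  have hs := sumInvHeight_pos S
  ext ρ
  refine and_congr_right fun hρ => ?_
  simp only [closedBall_subset_solid_iff S hρ.le, norm_gradient]
  rw [le_div_iff₀ hs]
  constructor
  · rintro ⟨c, hc⟩
    rw [sumInvHeight, Finset.mul_sum]
    refine le_of_le_of_eq ?_ ((affineBasis S).sum_coord_apply_eq_one c)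
    exact Finset.sum_le_sum fun j _ => hc j
  · intro h
    -- This is the incenter: at the maximal radius all the constraints are equalities.
    obtain ⟨c, hc⟩ := exists_coord_eq S (fun j => 1 / S.height j / sumInvHeight S)
      (by rw [← Finset.sum_div]; exact div_self hs.ne')
    refine ⟨c, fun j => ?_⟩
    have hj := S.height_pos j
    rw [hc, le_div_iff₀ hs, mul_right_comm]
    exact mul_le_of_le_one_left (by positivity) h

lemma absorbingRatios_eq (S : Affine.Simplex ℝ (EuclideanSpace ℝ (Fin n)) n) :
    absorbingRatios (Metric.closedBall 0 1) S = Set.Ici (sumInvHeight S) := by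
  have hs := sumInvHeight_pos S
  ext τ
  rw [mem_absorbingRatios_iff, inscribedRadii_eq, Set.mem_Ioc, inv_pos, one_div, Set.mem_Ici]
  exact ⟨fun h => (inv_le_inv₀ h.1 hs).1 h.2,
    fun h => ⟨hs.trans_le h, (inv_le_inv₀ (hs.trans_le h) hs).2 h⟩⟩

lemma alpha_eq (S : Affine.Simplex ℝ (EuclideanSpace ℝ (Fin n)) n) :
    alpha (Metric.closedBall 0 1) S = sumInvHeight S := by
  rw [alpha, absorbingRatios_eq, csInf_Ici]

lemma inradius_eq (S : Affine.Simplex ℝ (EuclideanSpace ℝ (Fin n)) n) :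
    inradius S = 1 / sumInvHeight S := by
  rw [inradius, inscribedRadii_eq, csSup_Ioc (one_div_pos.2 (sumInvHeight_pos S))]

/-- The columns of the inverse of the vertex matrix are the coefficients of the barycentric
coordinates. -/
noncomputable def coordMatrix (S : Affine.Simplex ℝ (EuclideanSpace ℝ (Fin n)) n) :
    Matrix (Fin (n + 1)) (Fin (n + 1)) ℝ :=
  Matrix.of fun i j =>
    Fin.snoc (α := fun _ => ℝ) (fun i : Fin n => gradient S j i) ((affineBasis S).coord j 0) i

/-- Entry (k, j) of the product is coordinate j evaluated at vertex k, as linear part plus value at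
the origin. -/
lemma vertexMatrix_mul_coordMatrix (S : Affine.Simplex ℝ (EuclideanSpace ℝ (Fin n)) n) :
    vertexMatrix S * coordMatrix S = 1 := by
  ext k j
  have h := coord_eq_add_inner S j (S.points k) 0
  rw [coord_point, sub_zero, PiLp.inner_apply] at h
  rw [Matrix.mul_apply, Fin.sum_univ_castSucc, Matrix.one_apply]
  simp only [vertexMatrix, coordMatrix, Matrix.of_apply, Fin.snoc_castSucc, Fin.snoc_last, one_mul]
  simp only [eq_comm (a := k), h, add_comm]
  simp

lemma sqrt_sum_inv_vertexMatrix (S : Affine.Simplex ℝ (EuclideanSpace ℝ (Fin n)) n)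
    (j : Fin (n + 1)) :
    Real.sqrt (∑ i : Fin n, ((vertexMatrix S)⁻¹ i.castSucc j) ^ 2) = 1 / S.height j := by
  rw [Matrix.inv_eq_right_inv (vertexMatrix_mul_coordMatrix S), ← norm_gradient,
    EuclideanSpace.norm_eq]
  simp [coordMatrix]

/-! ### Facets, parallel sections and volume -/

lemma mem_solid_faceOpposite_iff (S : Affine.Simplex ℝ (EuclideanSpace ℝ (Fin n)) n)
    (j : Fin (n + 1)) {x : EuclideanSpace ℝ (Fin n)} :
    x ∈ solid (S.faceOpposite j) ↔ x ∈ solid S ∧ (affineBasis S).coord j x = 0 := by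
  rw [solid, Affine.Simplex.range_faceOpposite_points]
  constructor
  · intro hx
    refine ⟨convexHull_mono (Set.image_subset_range _ _) hx, ?_⟩
    have hc : Convex ℝ ((affineBasis S).coord j ⁻¹' {0}) :=
      (convex_singleton 0).affine_preimage _
    refine convexHull_min ?_ hc hx
    rintro _ ⟨k, hk, rfl⟩
    simpa [coord_point] using Ne.symm hk
  · rintro ⟨hx, h0⟩
    rw [mem_solid_iff] at hx
    have hsum := (affineBasis S).sum_coord_apply_eq_one x
    have hx' := (affineBasis S).linear_combination_coord_eq_self x
    rw [← Finset.add_sum_erase _ _ (Finset.mem_univ j), h0, zero_add] at hsum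
    rw [← Finset.add_sum_erase _ _ (Finset.mem_univ j), h0, zero_smul, zero_add] at hx'
    rw [← hx']
    refine (convex_convexHull ℝ _).sum_mem (fun k _ => hx k) hsum fun k hk => ?_
    exact subset_convexHull ℝ _ ⟨k, Finset.ne_of_mem_erase hk, rfl⟩

/-- A section of a simplex parallel to a facet is a homothetic copy of that facet. -/
lemma solid_inter_coord_eq (S : Affine.Simplex ℝ (EuclideanSpace ℝ (Fin n)) n)
    (j : Fin (n + 1)) {t : ℝ} (ht : 0 < t) (ht1 : t ≤ 1) :
    solid S ∩ {y | (affineBasis S).coord j y = 1 - t} =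
      AffineMap.homothety (S.points j) t '' solid (S.faceOpposite j) := by
  ext y
  constructor
  · rintro ⟨hy, hyj⟩
    have e : AffineMap.homothety (S.points j) t (AffineMap.homothety (S.points j) t⁻¹ y) = y := by
      rw [← AffineMap.homothety_mul_apply, mul_inv_cancel₀ ht.ne', AffineMap.homothety_one,
        AffineMap.id_apply]
    rw [Set.mem_ofPred_eq] at hyj
    have h0 : (affineBasis S).coord j (AffineMap.homothety (S.points j) t⁻¹ y) = 0 := by
      rw [coord_homothety_point, hyj, if_pos rfl]
      field_simp
      ring
    refine ⟨_, (mem_solid_faceOpposite_iff S j).2 ⟨(mem_solid_iff S).2 fun k => ?_, h0⟩, e⟩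
    rcases eq_or_ne k j with rfl | hk
    · exact h0.ge
    · rw [coord_homothety_point, if_neg hk, mul_zero, add_zero]
      exact mul_nonneg (inv_nonneg.2 ht.le) ((mem_solid_iff S).1 hy k)
  · rintro ⟨x, hx, rfl⟩
    obtain ⟨hx, hxj⟩ := (mem_solid_faceOpposite_iff S j).1 hx
    refine ⟨(mem_solid_iff S).2 fun k => ?_, ?_⟩
    · have := mul_nonneg ht.le ((mem_solid_iff S).1 hx k)
      rw [coord_homothety_point]
      split_ifs <;> linarith
    · rw [Set.mem_ofPred_eq, coord_homothety_point, hxj, if_pos rfl]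
      ring

/-- The altitude is parallel to the gradient, so hyperplanes orthogonal to it are level sets of
coordinate j, which falls linearly from 1 at the vertex to 0 at the foot. -/
lemma mem_orthogonal_section_iff (S : Affine.Simplex ℝ (EuclideanSpace ℝ (Fin n)) n)
    (j : Fin (n + 1)) (t : ℝ) (y : EuclideanSpace ℝ (Fin n)) :
    y ∈ AffineSubspace.mk' (t • (S.altitudeFoot j - S.points j) +ᵥ S.points j)
        (ℝ ∙ (S.altitudeFoot j - S.points j))ᗮ ↔ (affineBasis S).coord j y = 1 - t := by
  have hj := S.height_pos j
  have hv : S.altitudeFoot j - S.points j = -(S.height j ^ 2) • gradient S j := by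
    rw [gradient, neg_smul, smul_inv_smul₀ (by positivity), neg_sub]
  rw [AffineSubspace.mem_mk', Submodule.mem_orthogonal_singleton_iff_inner_right, hv,
    real_inner_smul_left, neg_mul, neg_eq_zero, mul_eq_zero, or_iff_right (by positivity),
    coord_eq_add_inner S j y (S.points j), coord_point, if_pos rfl, vsub_eq_sub, vadd_eq_add,
    add_comm, ← sub_sub, inner_sub_right, real_inner_smul_right, real_inner_smul_right,
    real_inner_self_eq_norm_sq, norm_gradient]
  have e : t * (-S.height j ^ 2 * (1 / S.height j) ^ 2) = - t := by field_simp
  rw [e]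
  constructor <;> intro h <;> linarith

/-- The volume of a pyramid: `n` times the volume of a simplex is the product of any height and
the measure of the opposite facet. -/
lemma vol_eq_height_mul_facetMeasure (S : Affine.Simplex ℝ (EuclideanSpace ℝ (Fin n)) n)
    (j : Fin (n + 1)) : (n : ℝ) * vol S = S.height j * facetMeasure S j := by
  have hj := S.height_pos j
  have hn : (n : ℝ) ≠ 0 := Nat.cast_ne_zero.2 (NeZero.ne n)
  set v := S.altitudeFoot j - S.points j with hv_def
  have hv : ‖v‖ = S.height j := by rw [hv_def, norm_sub_rev, ← dist_eq_norm, Affine.Simplex.height]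
  have hv0 : v ≠ 0 := by rw [← norm_pos_iff, hv]; exact hj
  -- Fubini along the altitude: t is the fraction of it travelled from the vertex, whence the factor
  -- ‖v‖.
  have hint := EuclideanGeometry.euclideanHausdorffMeasure_eq_lintegral (S.points j) hv0
    (isCompact_solid S).measurableSet
  have hsec : ∀ t : ℝ, solid S ∩ (AffineSubspace.mk' (t • v +ᵥ S.points j) (ℝ ∙ v)ᗮ : Set _) =
      solid S ∩ {y | (affineBasis S).coord j y = 1 - t} := by
    intro t
    ext y
    exact and_congr_right fun _ => mem_orthogonal_section_iff S j t y
  have hae : ∀ᵐ t : ℝ, (μHE[n - 1] : MeasureTheory.Measure (EuclideanSpace ℝ (Fin n)))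
        (solid S ∩ {y | (affineBasis S).coord j y = 1 - t}) =
      (Set.Ioc (0 : ℝ) 1).indicator (fun t => ENNReal.ofReal (t ^ (n - 1)) *
        (μHE[n - 1] : MeasureTheory.Measure (EuclideanSpace ℝ (Fin n)))
          (solid (S.faceOpposite j))) t := by
    -- At t = 0 the section is the vertex alone; for n = 1 it has measure 1 while the indicator is
    -- 0, so this null set of parameters is discarded.
    filter_upwards [MeasureTheory.Measure.ae_ne MeasureTheory.volume 0] with t ht0
    by_cases ht : t ∈ Set.Ioc (0 : ℝ) 1
    · rw [Set.indicator_of_mem ht, solid_inter_coord_eq S j ht.1 ht.2,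
        MeasureTheory.euclideanHausdorffMeasure_homothety_image _ _ ht.1.ne', ENNReal.smul_def,
        smul_eq_mul, ENNReal.ofReal_pow ht.1.le, ENNReal.coe_pow]
      congr 2
      rw [← enorm_eq_nnnorm, Real.enorm_of_nonneg ht.1.le]
    · rw [Set.indicator_of_notMem ht]
      refine (congrArg _ (Set.eq_empty_of_forall_notMem fun y hy => ht ?_)).trans
        MeasureTheory.measure_empty
      have hyj : (affineBasis S).coord j y = 1 - t := hy.2
      have h0 := (mem_solid_iff S).1 hy.1
      have h1 : (affineBasis S).coord j y ≤ 1 := by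
        rw [← (affineBasis S).sum_coord_apply_eq_one y]
        exact Finset.single_le_sum (fun k _ => h0 k) (Finset.mem_univ j)
      refine ⟨lt_of_le_of_ne (by linarith) (Ne.symm ht0), by linarith [h0 j]⟩
  have hpow : ∫⁻ t in Set.Ioc (0 : ℝ) 1, ENNReal.ofReal (t ^ (n - 1)) =
      ENNReal.ofReal (1 / n) := by
    rw [← MeasureTheory.ofReal_integral_eq_lintegral_ofReal,
      ← intervalIntegral.integral_of_le zero_le_one, integral_pow]
    · have hpos : 0 < n := NeZero.pos n
      simp [Nat.cast_pred hpos, Nat.sub_add_cancel hpos, NeZero.ne n]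
    · exact (continuous_pow _).integrableOn_Ioc
    · exact (MeasureTheory.ae_restrict_mem measurableSet_Ioc).mono fun t ht => pow_nonneg ht.1.le _
  simp only [hsec, finrank_euclideanSpace_fin] at hint
  rw [MeasureTheory.lintegral_congr_ae hae, MeasureTheory.lintegral_indicator measurableSet_Ioc,
    MeasureTheory.lintegral_mul_const _ (by fun_prop), hpow,
    EuclideanSpace.euclideanHausdorffMeasure_eq_volume, ← ofReal_norm, hv] at hint
  rw [vol, facetMeasure, MeasureTheory.measureReal_def, hint, ENNReal.toReal_mul,
    ENNReal.toReal_mul, ENNReal.toReal_ofReal hj.le, ENNReal.toReal_ofReal (by positivity),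
    MeasureTheory.measureReal_def]
  field_simp

/-- The simplex contains a ball of positive radius. -/
lemma vol_pos (S : Affine.Simplex ℝ (EuclideanSpace ℝ (Fin n)) n) : 0 < vol S := by
  have h : (1 / sumInvHeight S) ∈ inscribedRadii S := by
    rw [inscribedRadii_eq]
    exact ⟨one_div_pos.2 (sumInvHeight_pos S), le_rfl⟩
  obtain ⟨hρ, c, hc⟩ := h
  exact ENNReal.toReal_pos
    ((Metric.measure_closedBall_pos MeasureTheory.volume c hρ).trans_le
      (MeasureTheory.measure_mono hc)).ne' (isCompact_solid S).measure_lt_top.ne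

lemma surface_div_vol (S : Affine.Simplex ℝ (EuclideanSpace ℝ (Fin n)) n) :
    surface S / ((n : ℝ) * vol S) = sumInvHeight S := by
  rw [surface, sumInvHeight, Finset.sum_div]
  refine Finset.sum_congr rfl fun j _ => ?_
  have hj := S.height_pos j
  have hn : (0 : ℝ) < n := Nat.cast_pos.2 (NeZero.pos n)
  rw [div_eq_div_iff (mul_pos hn (vol_pos S)).ne' hj.ne', one_mul,
    vol_eq_height_mul_facetMeasure S j, mul_comm]

end SimplexBall

theorem theorem1 {n : ℕ} [NeZero n] (S : Affine.Simplex ℝ (EuclideanSpace ℝ (Fin n)) n) :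
    -- the quantities in the equalities are well defined: the vertex matrix is invertible,
    -- and the minimum and the maximum that define `α` and the inradius are attained
    IsUnit (SimplexBall.vertexMatrix S) ∧
    IsLeast (SimplexBall.absorbingRatios (Metric.closedBall 0 1) S)
      (SimplexBall.alpha (Metric.closedBall 0 1) S) ∧
    IsGreatest (SimplexBall.inscribedRadii S) (SimplexBall.inradius S) ∧
    -- the four equalities
    SimplexBall.alpha (Metric.closedBall 0 1) S =
      ∑ j : Fin (n + 1),
        Real.sqrt (∑ i : Fin n, ((SimplexBall.vertexMatrix S)⁻¹ i.castSucc j) ^ 2) ∧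
    SimplexBall.alpha (Metric.closedBall 0 1) S = ∑ j : Fin (n + 1), 1 / S.height j ∧
    SimplexBall.alpha (Metric.closedBall 0 1) S = 1 / SimplexBall.inradius S ∧
    SimplexBall.alpha (Metric.closedBall 0 1) S =
      SimplexBall.surface S / ((n : ℝ) * SimplexBall.vol S) := by
  have hα := SimplexBall.alpha_eq S
  have hr := SimplexBall.inradius_eq S
  refine ⟨(Matrix.isUnit_iff_isUnit_det _).2
    (Matrix.isUnit_det_of_right_inverse (SimplexBall.vertexMatrix_mul_coordMatrix S)),
    ?_, ?_, ?_, hα, ?_, ?_⟩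
  · rw [hα, SimplexBall.absorbingRatios_eq]
    exact isLeast_Ici
  · rw [hr, SimplexBall.inscribedRadii_eq]
    exact isGreatest_Ioc (one_div_pos.2 (SimplexBall.sumInvHeight_pos S))
  · rw [hα]
    exact Finset.sum_congr rfl fun j _ => (SimplexBall.sqrt_sum_inv_vertexMatrix S j).symm
  · rw [hα, hr, one_div_one_div]
  · rw [hα, SimplexBall.surface_div_vol]
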